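/- Let $H=H_1\times\dots\times H_d$ be a product of probability measures on $\mathbb{R}$, and for each $i\in\{1,\dots,d\}$ and $k\in\mathbb{N}=\{0,1,2,\dots\}$ let $\psi^{(i)}_k$ be a real univariate polynomial of degree $k$ (for instance, the members of a family orthogonal with respect to $H_i$). For a multi-index $\alpha\in\mathbb{N}^d$ put $\Psi_\alpha(x)=\prod_{i=1}^d\psi^{(i)}_{\alpha_i}(x_i)$. Let $L\subset\mathbb{N}^d$ be a finite set of $P$ multi-indices, and let $\Psi(x)=(\Psi_\alpha(x))_{\alpha\in L}\in\mathbb{R}^{P}$. For $v\in\mathbb{R}^{P}$ and $i=1,\dots,d$ define $$S_i(v)=\frac{\sum_{\alpha\in L_i}v_\alpha^2}{\sum_{\alpha\in L,\ \alpha\neq 0}v_\alpha^2},\qquad S(v)=(S_1(v),\dots,S_d(v))^T,$$ where $L_i$ is the set of those $\alpha\in L$ whose only nonzero entry is $\alpha_i>0$. Let $f:\mathbb{R}^d\to\mathbb{R}$ be measurable, let $c\in\mathbb{R}^{P}$, and let $\varepsilon(x)=f(x)-c^T\Psi(x)$. Assume that $\Gamma=(\gamma_{r,s})_{r,s\in L}$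 with $\gamma_{r,s}=\mathbb{E}_{X\sim H}[\varepsilon(X)^2\Psi_r(X)\Psi_s(X)]$ is well defined and finite, and that the residual is orthogonal to the basis: $\mathbb{E}_{X\sim H}[\varepsilon(X)\Psi_r(X)]=0$ for all $r\in L$. Let $x_1,x_2,\dots$ be i.i.d. random vectors with law $H$ such that almost surely $$\frac1n\sum_{i=1}^n\Psi(x_i)\Psi(x_i)^T\longrightarrow\Sigma\qquad(n\to\infty),$$ where $\Sigma$ is a symmetric $P\times P$ matrix with $\det\Sigma>0$. For each $n$ let $\hat c_n$ be a (measurable) least-squares estimate, that is, almost surely a minimizer of $v\mapsto\frac1n\sum_{i=1}^n\left(f(x_i)-v^T\Psi(x_i)\right)^2$ over $v\in\mathbb{R}^{P}$. Let $B=\left.\frac{\partial S(v)}{\partial v}\right|_{v=c}\in\mathbb{R}^{d\times P}$, and assume that $$\det\left(B\,\Sigma^{-1}\Gamma\,\Sigma^{-1}B^T\right)\neq0.$$ Then $$\sqrt n\,\bigl(S(\hat c_n)-S(c)\bigr)\longrightarrow\mathcal N\left(0,\;B\,\Sigma^{-1}\Gamma\,\Sigma^{-1}B^T\right)\quad\text{in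 distribution as }n\to\infty.$$ -/

import Mathlib

open MeasureTheory ProbabilityTheory Filter Topology

namespace PCE

noncomputable section

/-- The tensor-product polynomial `Ψ_α(x) = ∏ i, ψ i (α i) (x i)`, where `ψ i k` is the member of
index `k` of the `i`-th family of univariate polynomials. -/
def basisFun {d : ℕ} (ψ : Fin d → ℕ → Polynomial ℝ) (α : Fin d → ℕ) (x : Fin d → ℝ) : ℝ :=
  ∏ i, (ψ i (α i)).eval (x i)

/-- The regressor vector `Ψ(x) = (Ψ_α(x))_{α ∈ L}` of the truncated expansion. -/
def basisVec {d : ℕ} (ψ : Fin d → ℕ → Polynomial ℝ) (L : Finset (Fin d → ℕ))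
    (x : Fin d → ℝ) : L → ℝ :=
  fun α => basisFun ψ α.1 x

/-- The truncated expansion `vᵀ Ψ(x) = ∑_{α ∈ L} v_α Ψ_α(x)`. -/
def expansion {d : ℕ} (ψ : Fin d → ℕ → Polynomial ℝ) (L : Finset (Fin d → ℕ))
    (v : L → ℝ) (x : Fin d → ℝ) : ℝ :=
  ∑ α, v α * basisVec ψ L x α

/-- The residual `ε(x) = f(x) - cᵀ Ψ(x)` of the model `f` with coefficients `c`. -/
def residual {d : ℕ} (ψ : Fin d → ℕ → Polynomial ℝ) (L : Finset (Fin d → ℕ))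
    (f : (Fin d → ℝ) → ℝ) (c : L → ℝ) (x : Fin d → ℝ) : ℝ :=
  f x - expansion ψ L c x

/-- The set of the nonzero multi-indices of `L`. -/
def nonzeroIndices {d : ℕ} (L : Finset (Fin d → ℕ)) : Finset L :=
  Finset.univ.filter fun α => α.1 ≠ 0

/-- The set of the multi-indices of `L` whose only nonzero entry is the `i`-th one. -/
def mainEffectIndices {d : ℕ} (L : Finset (Fin d → ℕ)) (i : Fin d) : Finset L :=
  Finset.univ.filter fun α => 0 < α.1 i ∧ ∀ j, j ≠ i → α.1 j = 0

/-- The main-effect Sobol' indices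
`S_i(v) = (∑_{α ∈ L_i} v_α ^ 2) / (∑_{α ∈ L, α ≠ 0} v_α ^ 2)`, `i = 1, …, d`. -/
def sobolIndex {d : ℕ} (L : Finset (Fin d → ℕ)) (v : L → ℝ) (i : Fin d) : ℝ :=
  (∑ α ∈ mainEffectIndices L i, v α ^ 2) / ∑ α ∈ nonzeroIndices L, v α ^ 2

/-- The matrix `B(c)` of the partial derivatives `∂ S_i / ∂ v_β` at `v = c`. -/
def sobolJacobian {d : ℕ} (L : Finset (Fin d → ℕ)) (c : L → ℝ) : Matrix (Fin d) L ℝ :=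
  Matrix.of fun i β => fderiv ℝ (fun v : L → ℝ => sobolIndex L v i) c (Pi.single β 1)

/-- The information matrix `A_n = ∑_{k < n} Ψ(x_k) Ψ(x_k)ᵀ` of the first `n` design points. -/
def informationMatrix {d : ℕ} (ψ : Fin d → ℕ → Polynomial ℝ) (L : Finset (Fin d → ℕ))
    (x : ℕ → Fin d → ℝ) (n : ℕ) : Matrix L L ℝ :=
  ∑ k ∈ Finset.range n, Matrix.vecMulVec (basisVec ψ L (x k)) (basisVec ψ L (x k))

/-- The vector `v` is a least-squares estimate from the training sample `(x_k, f (x_k))_{k < n}`: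
it minimizes the mean square error over all coefficient vectors. -/
def IsLeastSquares {d : ℕ} (ψ : Fin d → ℕ → Polynomial ℝ) (L : Finset (Fin d → ℕ))
    (f : (Fin d → ℝ) → ℝ) (x : ℕ → Fin d → ℝ) (n : ℕ) (v : L → ℝ) : Prop :=
  IsMinOn (fun w : L → ℝ =>
    (1 / (n : ℝ)) * ∑ k ∈ Finset.range n, (f (x k) - expansion ψ L w (x k)) ^ 2) Set.univ v

/-- The matrix `Γ` with entries `E (ε² Ψ_r Ψ_s)`, for inputs of law `H`. -/
def noiseMatrix {d : ℕ} (H : Measure (Fin d → ℝ)) (ψ : Fin d → ℕ → Polynomial ℝ)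
    (L : Finset (Fin d → ℕ)) (f : (Fin d → ℝ) → ℝ) (c : L → ℝ) : Matrix L L ℝ :=
  Matrix.of fun r s =>
    ∫ x, residual ψ L f c x ^ 2 * basisVec ψ L x r * basisVec ψ L x s ∂H

/-- The limiting covariance matrix `B Σ⁻¹ Γ Σ⁻¹ Bᵀ` of the estimated indices. -/
def limitCov {d : ℕ} (H : Measure (Fin d → ℝ)) (ψ : Fin d → ℕ → Polynomial ℝ)
    (L : Finset (Fin d → ℕ)) (f : (Fin d → ℝ) → ℝ) (c : L → ℝ) (Sig : Matrix L L ℝ) :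
    Matrix (Fin d) (Fin d) ℝ :=
  sobolJacobian L c * (Sig⁻¹ * noiseMatrix H ψ L f c * Sig⁻¹) * (sobolJacobian L c).transpose

end

end PCE

/-! Let `M n` be the empirical Gram matrix, and call `ε Ψ` the score. The normal equations centered
at `c` say that `M n` times the error `chat n - c` is the mean score, so almost surely, for large
`n`, the error is `(M n)⁻¹` applied to that mean. Scores are i.i.d. and centered with covariance
`Γ`: the strong law gives `chat n → c` almost surely, and the central limit theorem gives the
`√n`-scaled mean the limit `N(0, Γ)`.

The delta method needs no remainder term: a Carathéodory slope `q` writes the increment of `S`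
exactly as `q` at the error times the error, and `q → B`. Hence the scaled increment is `D n = q (M
n)⁻¹` applied to the normalized score sum, with `D n → B Σ⁻¹` almost surely, and Slutsky's theorem
concludes. -/

open Matrix

/-! ### Deterministic tools: slopes and least squares. -/

/-- Carathéodory's form of differentiability, with a measurable slope. -/
theorem exists_measurable_slope_of_differentiableAt {ι : Type*} [Fintype ι] [DecidableEq ι]
    {f : (ι → ℝ) → ℝ} {c : ι → ℝ} (hf : Measurable f) (hd : DifferentiableAt ℝ f c) :
    ∃ q : (ι → ℝ) → ι → ℝ, Measurable q ∧
      Tendsto q (𝓝 0) (𝓝 fun i => fderiv ℝ f c (Pi.single i 1)) ∧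
      ∀ h, f (c + h) - f c = q h ⬝ᵥ h := by
  set b : ι → ℝ := fun i => fderiv ℝ f c (Pi.single i 1) with hb
  have hbv (h : ι → ℝ) : fderiv ℝ f c h = b ⬝ᵥ h := by
    conv_lhs => rw [pi_eq_sum_univ' h]
    simp [dotProduct, hb, mul_comm]
  set ρ : (ι → ℝ) → ℝ := fun h => f (c + h) - f c - b ⬝ᵥ h with hρ
  have hρ0 : ρ =o[𝓝 0] fun h => h := by
    have := (hasFDerivAt_iff_isLittleO_nhds_zero.1 hd.hasFDerivAt)
    simpa only [hbv] using this
  have hsq (h : ι → ℝ) : ‖h‖ ^ 2 ≤ h ⬝ᵥ h := by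
    have h0 : 0 ≤ h ⬝ᵥ h := Finset.sum_nonneg fun i _ => mul_self_nonneg _
    have : ‖h‖ ≤ √(h ⬝ᵥ h) := by
      refine (pi_norm_le_iff_of_nonneg (Real.sqrt_nonneg _)).2 fun i => ?_
      refine Real.abs_le_sqrt ?_
      rw [sq]
      exact Finset.single_le_sum (f := fun j => h j * h j) (fun j _ => mul_self_nonneg _)
        (Finset.mem_univ i)
    calc ‖h‖ ^ 2 ≤ √(h ⬝ᵥ h) ^ 2 := by gcongr
      _ = _ := Real.sq_sqrt h0
  -- The remainder `ρ h` is spread along `h`, an explicit formula and hence measurable. At `h = 0`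
  -- division by zero makes the slope `b`.
  refine ⟨fun h i => b i + ρ h / (h ⬝ᵥ h) * h i, ?_, ?_, fun h => ?_⟩
  · have hm : Measurable ρ := by
      simp only [hρ, dotProduct]
      fun_prop
    simp only [dotProduct]
    fun_prop
  · refine tendsto_pi_nhds.2 fun i => ?_
    suffices Tendsto (fun h : ι → ℝ => ρ h / (h ⬝ᵥ h) * h i) (𝓝 0) (𝓝 0) by
      simpa using this.const_add (b i)
    have h1 : Tendsto (fun h : ι → ℝ => ‖ρ h‖ / ‖h‖) (𝓝 0) (𝓝 0) :=
      hρ0.norm_norm.tendsto_div_nhds_zero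
    refine squeeze_zero_norm (fun h => ?_) h1
    rcases eq_or_ne h 0 with rfl | hh
    · simp
    have hpos : 0 < ‖h‖ := norm_pos_iff.2 hh
    have hpos2 : 0 < h ⬝ᵥ h := lt_of_lt_of_le (by positivity) (hsq h)
    rw [norm_mul, norm_div, Real.norm_of_nonneg hpos2.le, div_mul_eq_mul_div,
      div_le_div_iff₀ hpos2 hpos, mul_assoc]
    gcongr
    calc ‖h i‖ * ‖h‖ ≤ ‖h‖ * ‖h‖ := by gcongr; exact norm_le_pi_norm h i
      _ = ‖h‖ ^ 2 := by ring
      _ ≤ _ := hsq h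
  · have e : (fun i => b i + ρ h / (h ⬝ᵥ h) * h i) = b + (ρ h / (h ⬝ᵥ h)) • h := by
      ext i; simp
    change f (c + h) - f c = (fun i => b i + ρ h / (h ⬝ᵥ h) * h i) ⬝ᵥ h
    rw [e, add_dotProduct, smul_dotProduct, smul_eq_mul]
    rcases eq_or_ne h 0 with rfl | hh
    · simp
    have : h ⬝ᵥ h ≠ 0 :=
      (lt_of_lt_of_le (by have := norm_pos_iff.2 hh; positivity) (hsq h)).ne'
    rw [div_mul_cancel₀ _ this]
    simp [hρ]

/-- If no multiple of `g` reduces the sum of squares of `a`, then `g` is orthogonal to `a`. -/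
theorem sum_mul_eq_zero_of_forall_sum_sq_le {κ : Type*} (s : Finset κ) (a g : κ → ℝ)
    (h : ∀ t : ℝ, ∑ k ∈ s, a k ^ 2 ≤ ∑ k ∈ s, (a k - t * g k) ^ 2) :
    ∑ k ∈ s, a k * g k = 0 := by
  have e (t : ℝ) : ∑ k ∈ s, (a k - t * g k) ^ 2 =
      ∑ k ∈ s, a k ^ 2 - 2 * t * ∑ k ∈ s, a k * g k + t ^ 2 * ∑ k ∈ s, g k ^ 2 := by
    rw [Finset.mul_sum, Finset.mul_sum, ← Finset.sum_sub_distrib, ← Finset.sum_add_distrib]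
    exact Finset.sum_congr rfl fun k _ => by ring
  set A := ∑ k ∈ s, a k * g k
  set G := ∑ k ∈ s, g k ^ 2
  have hG : 0 ≤ G := Finset.sum_nonneg fun k _ => sq_nonneg _
  -- Nearly the optimal step `A / G`; the `+ 1` covers `G = 0`.
  have h1 := h (A / (G + 1))
  rw [e] at h1
  have hG1 : 0 < G + 1 := by linarith
  have h2 : A ^ 2 * (G + 2) / (G + 1) ^ 2 ≤ 0 := by
    have : A ^ 2 * (G + 2) / (G + 1) ^ 2 = 2 * (A / (G + 1)) * A - (A / (G + 1)) ^ 2 * G := by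
      field_simp
      ring
    rw [this]
    linarith
  by_contra hA
  have : 0 < A ^ 2 * (G + 2) / (G + 1) ^ 2 := by positivity
  linarith

/-! ### Convergence in distribution and Gaussian laws. -/

section Distribution

variable {Ω : Type*} [MeasurableSpace Ω] {P : Measure Ω} [IsProbabilityMeasure P]

theorem MeasureTheory.TendstoInDistribution.id_of_hasLaw {Ω' E : Type*} [MeasurableSpace Ω']
    {P' : Measure Ω'} [IsProbabilityMeasure P'] [TopologicalSpace E] [MeasurableSpace E]
    [OpensMeasurableSpace E] {X : ℕ → Ω → E} {Z : Ω' → E} {ν : Measure E} [IsProbabilityMeasure ν]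
    (h : TendstoInDistribution X atTop Z (fun _ => P) P') (hZ : HasLaw Z ν P') :
    TendstoInDistribution X atTop id (fun _ => P) ν where
  forall_aemeasurable := h.forall_aemeasurable
  aemeasurable_limit := aemeasurable_id
  tendsto := by
    have e : (⟨ν.map id, Measure.isProbabilityMeasure_map aemeasurable_id⟩ : ProbabilityMeasure E)
        = ⟨P'.map Z, Measure.isProbabilityMeasure_map h.aemeasurable_limit⟩ :=
      Subtype.ext (by simp [hZ.map_eq])
    rw [e]
    exact h.tendsto

/-- **Slutsky's theorem** for random matrices acting on random vectors. -/
theorem MeasureTheory.TendstoInDistribution.mulVec_of_ae_tendsto {ι κ : Type*} [Fintype ι] [Fintype κ]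
    {μ : Measure (EuclideanSpace ℝ ι)} [IsProbabilityMeasure μ]
    {Z : ℕ → Ω → EuclideanSpace ℝ ι}
    (hZ : TendstoInDistribution Z atTop id (fun _ => P) μ)
    {A : ℕ → Ω → κ → ι → ℝ} (hA : ∀ n, AEMeasurable (A n) P) {A₀ : κ → ι → ℝ}
    (hA_lim : ∀ᵐ ω ∂P, Tendsto (fun n => A n ω) atTop (𝓝 A₀))
    {T : ℕ → Ω → EuclideanSpace ℝ κ} (hT : ∀ n, AEMeasurable (T n) P)
    (hTA : ∀ᵐ ω ∂P, ∀ᶠ n in atTop,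
      T n ω = WithLp.toLp 2 ((Matrix.of (A n ω)) *ᵥ (Z n ω).ofLp)) :
    TendstoInDistribution T atTop
      (fun z : EuclideanSpace ℝ ι => WithLp.toLp 2 ((Matrix.of A₀) *ᵥ z.ofLp)) (fun _ => P) μ := by
  set g : EuclideanSpace ℝ ι × (κ → ι → ℝ) → EuclideanSpace ℝ κ :=
    fun p => WithLp.toLp 2 ((Matrix.of p.2) *ᵥ p.1.ofLp) with hg
  have hgc : Continuous g := by
    refine (PiLp.continuous_toLp 2 _).comp (continuous_pi fun i => ?_)
    simp only [mulVec, dotProduct, Matrix.of_apply]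
    fun_prop
  have hAm : TendstoInMeasure P A atTop fun _ => A₀ :=
    tendstoInMeasure_of_tendsto_ae (fun n => (hA n).aestronglyMeasurable) hA_lim
  have h1 := hZ.continuous_comp_prodMk_of_tendstoInMeasure_const hgc hAm hA
  -- `T n` is only eventually equal to the product, but their difference then tends to zero almost
  -- surely, hence in measure.
  refine tendstoInDistribution_of_tendstoInMeasure_sub T _ h1 ?_ hT
  refine tendstoInMeasure_of_tendsto_ae
    (fun n => ((hT n).sub (h1.forall_aemeasurable n)).aestronglyMeasurable) ?_
  filter_upwards [hTA] with ω hω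
  refine tendsto_const_nhds.congr' ?_
  filter_upwards [hω] with n hn
  simp [hn, hg]

/-- Characteristic functions determine the law: moving `A` across the inner product evaluates the
Gaussian one at `Aᵀ t`. -/
theorem hasLaw_multivariateGaussian_mulVec {ι κ : Type*} [Fintype ι] [Fintype κ] [DecidableEq ι]
    [DecidableEq κ] {S : Matrix ι ι ℝ} (hS : S.PosSemidef) (A : Matrix κ ι ℝ) :
    HasLaw (fun z : EuclideanSpace ℝ ι => (WithLp.toLp 2 (A *ᵥ z.ofLp) : EuclideanSpace ℝ κ))
      (multivariateGaussian 0 (A * S * Aᵀ)) (multivariateGaussian 0 S) := by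
  have hc : Continuous fun z : EuclideanSpace ℝ ι =>
      (WithLp.toLp 2 (A *ᵥ z.ofLp) : EuclideanSpace ℝ κ) := by
    refine (PiLp.continuous_toLp 2 _).comp (continuous_pi fun i => ?_)
    simp only [mulVec, dotProduct]
    fun_prop
  have hS' : (A * S * Aᵀ).PosSemidef := by
    simpa using hS.mul_mul_conjTranspose_same A
  refine ⟨hc.measurable.aemeasurable, ?_⟩
  have := Measure.isProbabilityMeasure_map (μ := multivariateGaussian 0 S)
    hc.measurable.aemeasurable
  refine Measure.ext_of_charFun (funext fun t => ?_)
  have e : charFun ((multivariateGaussian 0 S).map fun z : EuclideanSpace ℝ ι =>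
      (WithLp.toLp 2 (A *ᵥ z.ofLp) : EuclideanSpace ℝ κ)) t =
      charFun (multivariateGaussian 0 S) (WithLp.toLp 2 (Aᵀ *ᵥ t.ofLp)) := by
    rw [charFun_apply, charFun_apply, integral_map hc.measurable.aemeasurable (by fun_prop)]
    congr! 5 with z
    simp only [EuclideanSpace.inner_eq_star_dotProduct, star_trivial]
    rw [dotProduct_mulVec, mulVec_transpose]
  rw [e, charFun_multivariateGaussian hS, charFun_multivariateGaussian hS']
  congr 2
  · simp
  · congr 2
    simp [← mulVec_mulVec, dotProduct_mulVec, mulVec_transpose]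

/-- The multivariate **central limit theorem** for centered random vectors. -/
theorem tendstoInDistribution_inv_sqrt_smul_sum {ι : Type*} [Fintype ι] [DecidableEq ι]
    {Y : ℕ → Ω → EuclideanSpace ℝ ι} (hmem : MemLp (Y 0) 2 P) (h0 : P[Y 0] = 0)
    {S : Matrix ι ι ℝ} (hS : S.PosSemidef) (hcov : ∀ i j, ∫ ω, Y 0 ω i * Y 0 ω j ∂P = S i j)
    (hindep : iIndepFun Y P) (hident : ∀ k, IdentDistrib (Y k) (Y 0) P P) :
    TendstoInDistribution (fun (n : ℕ) ω => (√(n : ℝ))⁻¹ • ∑ k ∈ Finset.range n, Y k ω)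
      atTop id (fun _ => P) (multivariateGaussian 0 S) where
  forall_aemeasurable n := by
    have := fun k => (hident k).aemeasurable_fst
    fun_prop
  aemeasurable_limit := aemeasurable_id
  tendsto := by
    refine ProbabilityMeasure.tendsto_iff_tendsto_charFun.2 fun t => ?_
    have hm : Measurable fun y : EuclideanSpace ℝ ι => (inner ℝ y t : ℝ) := by fun_prop
    have hmem' : MemLp (fun ω => inner ℝ (Y 0 ω) t) 2 P := hmem.inner_const t
    have hint : Integrable (Y 0) P := hmem.integrable (by norm_num)
    have hmean : P[fun ω => inner ℝ (Y 0 ω) t] = 0 := by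
      have := integral_inner (𝕜 := ℝ) hint t
      simp_rw [real_inner_comm t] at this ⊢
      rw [this, h0, inner_zero_right]
    have hmemc (i : ι) : MemLp (fun ω => Y 0 ω i) 2 P := 
      ((EuclideanSpace.proj (𝕜 := ℝ) i).comp_memLp' hmem)
    have hvar : Var[fun ω => inner ℝ (Y 0 ω) t; P] = t.ofLp ⬝ᵥ S *ᵥ t.ofLp := by
      rw [variance_of_integral_eq_zero hmem'.aestronglyMeasurable.aemeasurable hmean]
      have e (ω : Ω) : (inner ℝ (Y 0 ω) t) ^ 2 =
          ∑ i, ∑ j, t i * (Y 0 ω i * Y 0 ω j) * t j := by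
        rw [EuclideanSpace.inner_eq_star_dotProduct, sq, dotProduct, Finset.sum_mul_sum]
        refine Finset.sum_congr rfl fun i _ => Finset.sum_congr rfl fun j _ => ?_
        simp; ring
      have hij (i j : ι) : Integrable (fun ω => t i * (Y 0 ω i * Y 0 ω j) * t j) P :=
        (((hmemc i).integrable_mul (hmemc j)).const_mul _).mul_const _
      simp_rw [e]
      rw [integral_finsetSum _ fun i _ => integrable_finsetSum _ fun j _ => hij i j]
      simp_rw [integral_finsetSum _ fun j _ => hij _ j, integral_mul_const, integral_const_mul,
        hcov, dotProduct, mulVec, dotProduct, Finset.mul_sum, mul_assoc]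
    -- Cramér–Wold: the scalar theorem for the projections on `t`, read at frequency 1, is the
    -- vector statement at frequency `t`.
    have h1 := tendstoInDistribution_inv_sqrt_mul_sum_sub (P := P)
      (X := fun k ω => inner ℝ (Y k ω) t) (Y := id)
      (P' := gaussianReal 0 Var[fun ω => inner ℝ (Y 0 ω) t; P].toNNReal)
      HasLaw.id hmem' (hindep.comp (fun _ y => inner ℝ y t) fun _ => hm)
      fun k => (hident k).comp hm
    have h2 := ProbabilityMeasure.tendsto_iff_tendsto_charFun.1 h1.tendsto 1
    have hSum (n : ℕ) : AEMeasurable (fun ω => (√(n : ℝ))⁻¹ • ∑ k ∈ Finset.range n, Y k ω) P := by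
      have := fun k => (hident k).aemeasurable_fst
      fun_prop
    have hSum' (n : ℕ) : AEMeasurable (fun ω => (√(n : ℝ))⁻¹ *
        (∑ k ∈ Finset.range n, inner ℝ (Y k ω) t - n * ∫ ω, inner ℝ (Y 0 ω) t ∂P)) P :=
      h1.forall_aemeasurable n
    simp only [ProbabilityMeasure.coe_mk, Measure.map_id] at h2 ⊢
    convert h2 using 2 with n
    · rw [charFun_apply, charFun_apply, integral_map (hSum n) (by fun_prop),
        integral_map (hSum' n) (by fun_prop)]
      congr! 5 with ω
      rw [hmean, real_inner_smul_left, sum_inner]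
      simp
    · rw [charFun_multivariateGaussian hS, charFun_gaussianReal, hvar,
        Real.coe_toNNReal _ (by simpa using hS.dotProduct_mulVec_nonneg t.ofLp)]
      simp

end Distribution

/-! ### Measurability and limits of matrix operations. -/

theorem measurable_matrix_inv_apply {ι : Type*} [Fintype ι] [DecidableEq ι] (i j : ι) :
    Measurable fun M : ι → ι → ℝ => (Matrix.of M)⁻¹ i j := by
  have h0 : Continuous fun M : ι → ι → ℝ => Matrix.of M :=
    continuous_matrix fun i j => (continuous_apply j).comp (continuous_apply i)
  have h1 : Continuous fun M : ι → ι → ℝ => (Matrix.of M).det := h0.matrix_det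
  have h2 : Continuous fun M : ι → ι → ℝ => (Matrix.of M).adjugate i j :=
    h0.matrix_adjugate.matrix_elem i j
  simp only [Matrix.inv_def, Ring.inverse_eq_inv', Matrix.smul_apply, smul_eq_mul]
  exact h1.measurable.inv.mul h2.measurable

theorem tendsto_matrix_inv {ι α : Type*} [Fintype ι] [DecidableEq ι] {l : Filter α}
    {M : α → Matrix ι ι ℝ} {S : Matrix ι ι ℝ} (hM : Tendsto M l (𝓝 S)) (hS : S.det ≠ 0) :
    Tendsto (fun a => (M a)⁻¹) l (𝓝 S⁻¹) := by
  have h1 : Tendsto (fun a => (M a).det) l (𝓝 S.det) :=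
    ((continuous_id (X := Matrix ι ι ℝ)).matrix_det.tendsto S).comp hM
  have h2 : Tendsto (fun a => (M a).adjugate) l (𝓝 S.adjugate) :=
    ((continuous_id (X := Matrix ι ι ℝ)).matrix_adjugate.tendsto S).comp hM
  simp only [Matrix.inv_def, Ring.inverse_eq_inv']
  exact (h1.inv₀ hS).smul h2

theorem tendsto_matrix_mulVec {ι κ α : Type*} [Fintype ι] {l : Filter α}
    {M : α → Matrix κ ι ℝ} {S : Matrix κ ι ℝ} {v : α → ι → ℝ} {w : ι → ℝ}
    (hM : Tendsto M l (𝓝 S)) (hv : Tendsto v l (𝓝 w)) :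
    Tendsto (fun a => M a *ᵥ v a) l (𝓝 (S *ᵥ w)) := by
  have h : Continuous fun p : Matrix κ ι ℝ × (ι → ℝ) => p.1 *ᵥ p.2 :=
    continuous_fst.matrix_mulVec continuous_snd
  exact (h.tendsto (S, w)).comp (hM.prodMk_nhds hv)

theorem tendsto_matrix_mul {ι κ ν α : Type*} [Fintype ι] {l : Filter α}
    {M : α → Matrix κ ι ℝ} {S : Matrix κ ι ℝ} {N : α → Matrix ι ν ℝ} {T : Matrix ι ν ℝ}
    (hM : Tendsto M l (𝓝 S)) (hN : Tendsto N l (𝓝 T)) :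
    Tendsto (fun a => M a * N a) l (𝓝 (S * T)) := by
  have h : Continuous fun p : Matrix κ ι ℝ × Matrix ι ν ℝ => p.1 * p.2 :=
    continuous_fst.matrix_mul continuous_snd
  exact (h.tendsto (S, T)).comp (hM.prodMk_nhds hN)

/-! ### The score, its moments, and the normal equations. -/

namespace PCE

variable {d : ℕ} {ψ : Fin d → ℕ → Polynomial ℝ} {L : Finset (Fin d → ℕ)}
  {f : (Fin d → ℝ) → ℝ} {c : L → ℝ}

theorem measurable_basisVec (r : L) : Measurable fun x => basisVec ψ L x r := by
  refine Continuous.measurable ?_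
  unfold basisVec basisFun
  fun_prop

theorem aemeasurable_residual {μ : Measure (Fin d → ℝ)} (hf : AEMeasurable f μ) :
    AEMeasurable (residual ψ L f c) μ := by
  have := measurable_basisVec (ψ := ψ) (L := L)
  unfold residual expansion
  fun_prop

theorem measurable_sobolIndex (i : Fin d) : Measurable fun v => sobolIndex L v i := by
  unfold sobolIndex
  fun_prop

/-- Where an index is not differentiable, `fderiv` defaults to zero, so a row of the Jacobian, and
with it the determinant, vanishes. -/
theorem sobolIndex_differentiableAt_of_det_ne_zero {A : Matrix L L ℝ}
    (h : (sobolJacobian L c * A * (sobolJacobian L c)ᵀ).det ≠ 0) (i : Fin d) :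
    DifferentiableAt ℝ (fun v => sobolIndex L v i) c := by
  by_contra hi
  refine h (Matrix.det_eq_zero_of_row_eq_zero i fun j => ?_)
  have hrow (β : L) : sobolJacobian L c i β = 0 := by
    simp [sobolJacobian, fderiv_zero_of_not_differentiableAt hi]
  simp [Matrix.mul_apply, hrow]

variable (ψ L f c) in
/-- The score `ε(x) Ψ(x)` of the least-squares problem at the true coefficients. -/
noncomputable def score (x : Fin d → ℝ) : EuclideanSpace ℝ L :=
  WithLp.toLp 2 fun r => residual ψ L f c x * basisVec ψ L x r

theorem aemeasurable_score {μ : Measure (Fin d → ℝ)} (hf : AEMeasurable f μ) :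
    AEMeasurable (score ψ L f c) μ := by
  refine (WithLp.measurable_toLp 2 _).comp_aemeasurable (aemeasurable_pi_iff.2 fun r => ?_)
  exact (aemeasurable_residual hf).mul (measurable_basisVec r).aemeasurable

theorem score_mul_score (x : Fin d → ℝ) (r s : L) :
    score ψ L f c x r * score ψ L f c x s =
      residual ψ L f c x ^ 2 * basisVec ψ L x r * basisVec ψ L x s := by
  simp only [score]
  ring

theorem memLp_score {μ : Measure (Fin d → ℝ)} (hf : AEMeasurable f μ)
    (hΓ : ∀ r s : L, Integrable (fun x => residual ψ L f c x ^ 2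
      * basisVec ψ L x r * basisVec ψ L x s) μ) :
    MemLp (score ψ L f c) 2 μ := by
  refine MemLp.of_eval_piLp fun r => ?_
  refine (memLp_two_iff_integrable_sq ?_).2 ?_
  · exact ((aemeasurable_residual hf).mul
      (measurable_basisVec r).aemeasurable).aestronglyMeasurable
  · refine (hΓ r r).congr (ae_of_all _ fun x => ?_)
    simp only [sq (score ψ L f c x r), score_mul_score]

/-- The quadratic form at `v` is the integral of the square of `ε · vᵀΨ`. -/
theorem posSemidef_noiseMatrix {μ : Measure (Fin d → ℝ)}
    (hΓ : ∀ r s : L, Integrable (fun x => residual ψ L f c x ^ 2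
      * basisVec ψ L x r * basisVec ψ L x s) μ) :
    (noiseMatrix μ ψ L f c).PosSemidef := by
  refine Matrix.PosSemidef.of_dotProduct_mulVec_nonneg ?_ fun v => ?_
  · ext r s
    simp only [noiseMatrix, Matrix.conjTranspose_apply, Matrix.of_apply, star_trivial]
    exact integral_congr_ae (ae_of_all _ fun x => by ring)
  · have e : star v ⬝ᵥ (noiseMatrix μ ψ L f c) *ᵥ v =
        ∫ x, (residual ψ L f c x * expansion ψ L v x) ^ 2 ∂μ := by
      have hx (x : Fin d → ℝ) : (residual ψ L f c x * expansion ψ L v x) ^ 2 =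
          ∑ r, ∑ s, v r * (residual ψ L f c x ^ 2 * basisVec ψ L x r * basisVec ψ L x s) * v s := by
        rw [mul_pow, expansion, sq (∑ α, _), Finset.sum_mul_sum, Finset.mul_sum]
        simp_rw [Finset.mul_sum]
        exact Finset.sum_congr rfl fun r _ => Finset.sum_congr rfl fun s _ => by ring
      have hrs (r s : L) := ((hΓ r s).const_mul (v r)).mul_const (v s)
      simp_rw [hx]
      rw [integral_finsetSum _ fun r _ => integrable_finsetSum _ fun s _ => hrs r s]
      simp_rw [integral_finsetSum _ fun s _ => hrs _ s, integral_mul_const, integral_const_mul]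
      simp only [dotProduct, mulVec, Finset.mul_sum, star_trivial, noiseMatrix, Matrix.of_apply,
        mul_assoc]
    rw [e]
    exact integral_nonneg fun x => sq_nonneg _

theorem expansion_add (v w : L → ℝ) (x : Fin d → ℝ) :
    expansion ψ L (v + w) x = expansion ψ L v x + expansion ψ L w x := by
  simp [expansion, add_mul, Finset.sum_add_distrib]

theorem expansion_smul (t : ℝ) (v : L → ℝ) (x : Fin d → ℝ) :
    expansion ψ L (t • v) x = t * expansion ψ L v x := by
  simp [expansion, Finset.mul_sum, mul_assoc]

/-- The normal equations, centered at an arbitrary coefficient vector. -/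
theorem IsLeastSquares.informationMatrix_mulVec_sub {x : ℕ → Fin d → ℝ} {n : ℕ} {v : L → ℝ}
    (h : IsLeastSquares ψ L f x n v) (c : L → ℝ) :
    informationMatrix ψ L x n *ᵥ (v - c) = (∑ k ∈ Finset.range n, score ψ L f c (x k)).ofLp := by
  ext r
  have h0 : ∑ k ∈ Finset.range n, (f (x k) - expansion ψ L v (x k)) * basisVec ψ L (x k) r = 0 := by
    refine sum_mul_eq_zero_of_forall_sum_sq_le _ _ _ fun t => ?_
    -- For `n = 0` the factor `1 / n` is zero and minimality is vacuous, but the sums are empty.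
    rcases Nat.eq_zero_or_pos n with rfl | hn
    · simp
    have h1 := isMinOn_iff.1 h (v + t • Pi.single r 1) (Set.mem_univ _)
    have hn' : (0 : ℝ) < 1 / n := by positivity
    refine (le_of_mul_le_mul_left h1 hn').trans_eq (Finset.sum_congr rfl fun k _ => ?_)
    have : expansion ψ L (Pi.single r 1) (x k) = basisVec ψ L (x k) r := by
      simp [expansion, Pi.single_apply]
    rw [expansion_add, expansion_smul, this, sub_add_eq_sub_sub]
  have h2 : (informationMatrix ψ L x n *ᵥ (v - c)) r =
      ∑ k ∈ Finset.range n, (expansion ψ L v (x k) - expansion ψ L c (x k)) *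
        basisVec ψ L (x k) r := by
    rw [informationMatrix, Matrix.sum_mulVec, Finset.sum_apply]
    refine Finset.sum_congr rfl fun k _ => ?_
    simp only [mulVec, dotProduct, Matrix.vecMulVec_apply, expansion, ← Finset.sum_sub_distrib,
      Finset.sum_mul, Pi.sub_apply]
    exact Finset.sum_congr rfl fun s _ => by ring
  rw [h2, ← add_zero (∑ k ∈ _, _), ← h0, ← Finset.sum_add_distrib, WithLp.ofLp_sum,
    Finset.sum_apply]
  refine Finset.sum_congr rfl fun k _ => ?_
  simp only [score, residual]
  ring

theorem aemeasurable_informationMatrix_apply {Ω : Type*} [MeasurableSpace Ω] {P : Measure Ω}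
    {X : ℕ → Ω → (Fin d → ℝ)} (hX : ∀ k, AEMeasurable (X k) P) (n : ℕ) (r s : L) :
    AEMeasurable (fun ω => informationMatrix ψ L (fun k => X k ω) n r s) P := by
  have hb (k : ℕ) (r : L) : AEMeasurable (fun ω => basisVec ψ L (X k ω) r) P :=
    (measurable_basisVec r).comp_aemeasurable (hX k)
  simp only [informationMatrix, Matrix.sum_apply, Matrix.vecMulVec_apply]
  exact Finset.aemeasurable_fun_sum _ fun k _ => (hb k r).mul (hb k s)

end PCE

/-! ### Asymptotic normality of the estimated indices. -/

theorem theorem1 {Ω : Type*} [MeasurableSpace Ω] (P : Measure Ω) [IsProbabilityMeasure P]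
    -- input distribution with independent marginals, univariate polynomials, truncation set, model
    {d : ℕ} (H : Fin d → Measure ℝ) [∀ i, IsProbabilityMeasure (H i)]
    (ψ : Fin d → ℕ → Polynomial ℝ) (hψ : ∀ i k, (ψ i k).degree = (k : WithBot ℕ))
    (L : Finset (Fin d → ℕ))
    (f : (Fin d → ℝ) → ℝ) (hf : AEMeasurable f (Measure.pi H))
    -- the true coefficients: the residual is orthogonal to the basis, and `Γ` is finite
    (c : L → ℝ)
    (hΓ : ∀ r s : L, Integrable (fun x => PCE.residual ψ L f c x ^ 2
      * PCE.basisVec ψ L x r * PCE.basisVec ψ L x s) (Measure.pi H))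
    (horth : ∀ r : L,
      ∫ x, PCE.residual ψ L f c x * PCE.basisVec ψ L x r ∂(Measure.pi H) = 0)
    -- the i.i.d. design points
    (X : ℕ → Ω → (Fin d → ℝ)) (hX_law : ∀ k, HasLaw (X k) (Measure.pi H) P)
    (hX_indep : iIndepFun X P)
    (Sig : Matrix L L ℝ) (hSig_symm : Sig.IsSymm) (hSig_det : 0 < Sig.det)
    (hSig_lim : ∀ᵐ ω ∂P, Tendsto
      (fun n : ℕ => (1 / (n : ℝ)) • PCE.informationMatrix ψ L (fun k => X k ω) n) atTop (𝓝 Sig))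
    -- the least-squares estimates
    (chat : ℕ → Ω → (L → ℝ)) (hchat_meas : ∀ n, AEMeasurable (chat n) P)
    (hchat : ∀ n, ∀ᵐ ω ∂P, PCE.IsLeastSquares ψ L f (fun k => X k ω) n (chat n ω))
    -- the limiting covariance matrix is nonsingular
    (hcov : (PCE.limitCov (Measure.pi H) ψ L f c Sig).det ≠ 0) :
    TendstoInDistribution
      (fun (n : ℕ) (ω : Ω) => (WithLp.toLp 2
        (fun i : Fin d => √(n : ℝ) * (PCE.sobolIndex L (chat n ω) i - PCE.sobolIndex L c i)) :
          EuclideanSpace ℝ (Fin d)))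
      atTop (id : EuclideanSpace ℝ (Fin d) → EuclideanSpace ℝ (Fin d)) (fun _ => P)
      (multivariateGaussian 0 (PCE.limitCov (Measure.pi H) ψ L f c Sig)) := by
  have hXm (k : ℕ) : AEMeasurable (X k) P := (hX_law k).aemeasurable
  have hXid (k : ℕ) : IdentDistrib (X k) (X 0) P P :=
    ⟨hXm k, hXm 0, by rw [(hX_law k).map_eq, (hX_law 0).map_eq]⟩
  set μ := Measure.pi H with hμ
  set B := PCE.sobolJacobian L c with hB
  set Γ := PCE.noiseMatrix μ ψ L f c with hΓdef
  set Y : ℕ → Ω → EuclideanSpace ℝ L := fun k ω => PCE.score ψ L f c (X k ω) with hY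
  have hscore : AEMeasurable (PCE.score ψ L f c) μ := PCE.aemeasurable_score hf
  have hscoreX (k : ℕ) : AEMeasurable (PCE.score ψ L f c) (P.map (X k)) := by
    rwa [(hX_law k).map_eq]
  have hYindep : iIndepFun Y P := hX_indep.comp₀ (fun _ => PCE.score ψ L f c) hXm hscoreX
  have hYident (k : ℕ) : IdentDistrib (Y k) (Y 0) P P :=
    (hXid k).comp_of_aemeasurable (hscoreX k)
  have hscoreL2 : MemLp (PCE.score ψ L f c) 2 μ := PCE.memLp_score hf hΓ
  have hYmem : MemLp (Y 0) 2 P := by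
    have : MemLp (PCE.score ψ L f c) 2 (P.map (X 0)) := by rwa [(hX_law 0).map_eq]
    exact this.comp_of_map (hXm 0)
  have hYmean : P[Y 0] = 0 := by
    have h1 : P[Y 0] = ∫ x, PCE.score ψ L f c x ∂μ :=
      (hX_law 0).integral_comp hscore.aestronglyMeasurable
    rw [h1]
    ext r
    have h2 := (EuclideanSpace.proj (𝕜 := ℝ) r).integral_comp_comm
      (hscoreL2.integrable (by norm_num))
    exact h2.symm.trans (horth r)
  have hYcov (r s : L) : ∫ ω, Y 0 ω r * Y 0 ω s ∂P = Γ r s := by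
    simp only [hY, PCE.score_mul_score]
    exact (hX_law 0).integral_comp (hΓ r s).aestronglyMeasurable
  have hΓpsd : Γ.PosSemidef := PCE.posSemidef_noiseMatrix hΓ
  have hclt := tendstoInDistribution_inv_sqrt_smul_sum hYmem hYmean hΓpsd hYcov hYindep hYident
  have hslln := strong_law_ae Y (hYmem.integrable (by norm_num))
    (fun i j hij => hYindep.indepFun hij) hYident
  rw [hYmean] at hslln
  choose q hq_meas hq_lim hq using fun i => exists_measurable_slope_of_differentiableAt
    (PCE.measurable_sobolIndex i) (PCE.sobolIndex_differentiableAt_of_det_ne_zero hcov i)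
  set M : ℕ → Ω → Matrix L L ℝ := fun n ω =>
    (1 / (n : ℝ)) • PCE.informationMatrix ψ L (fun k => X k ω) n with hM
  -- the error of the estimate is `Mₙ⁻¹` times the mean score once `Mₙ` is invertible
  have herr : ∀ᵐ ω ∂P, ∀ᶠ n in atTop, chat n ω - c =
      (M n ω)⁻¹ *ᵥ ((n : ℝ)⁻¹ • ∑ k ∈ Finset.range n, Y k ω).ofLp := by
    filter_upwards [hSig_lim, ae_all_iff.2 hchat] with ω hω hls
    have hdet : Tendsto (fun n => (M n ω).det) atTop (𝓝 Sig.det) :=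
      ((continuous_id (X := Matrix L L ℝ)).matrix_det.tendsto Sig).comp hω
    filter_upwards [hdet.eventually_ne hSig_det.ne'] with n hn
    have h1 : ((n : ℝ)⁻¹ • ∑ k ∈ Finset.range n, Y k ω).ofLp = M n ω *ᵥ (chat n ω - c) := by
      simp only [hM, Matrix.smul_mulVec, (hls n).informationMatrix_mulVec_sub c, one_div, hY,
        WithLp.ofLp_smul]
    rw [h1, Matrix.mulVec_mulVec, Matrix.nonsing_inv_mul _ (isUnit_iff_ne_zero.2 hn),
      Matrix.one_mulVec]
  have hMinv : ∀ᵐ ω ∂P, Tendsto (fun n => (M n ω)⁻¹) atTop (𝓝 Sig⁻¹) := by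
    filter_upwards [hSig_lim] with ω hω
    exact tendsto_matrix_inv hω hSig_det.ne'
  have hcons : ∀ᵐ ω ∂P, Tendsto (fun n => chat n ω - c) atTop (𝓝 0) := by
    filter_upwards [herr, hMinv, hslln] with ω h1 h2 h3
    have h4 := tendsto_matrix_mulVec h2 (((PiLp.continuous_ofLp 2 _).tendsto _).comp h3)
    rw [WithLp.ofLp_zero, Matrix.mulVec_zero] at h4
    exact h4.congr' (h1.mono fun n hn => hn.symm)
  set D : ℕ → Ω → Fin d → L → ℝ := fun n ω =>
    (Matrix.of fun i => q i (chat n ω - c)) * (M n ω)⁻¹ with hD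
  have hDmeas (n : ℕ) : AEMeasurable (D n) P := by
    have hMm : AEMeasurable (fun (ω : Ω) (r s : L) => M n ω r s) P := by
      refine aemeasurable_pi_iff.2 fun r => aemeasurable_pi_iff.2 fun s => ?_
      exact (PCE.aemeasurable_informationMatrix_apply hXm n r s).const_mul _
    refine aemeasurable_pi_iff.2 fun i => aemeasurable_pi_iff.2 fun s => ?_
    simp only [hD, Matrix.mul_apply, Matrix.of_apply]
    refine Finset.aemeasurable_fun_sum _ fun r _ => AEMeasurable.mul ?_ ?_
    · exact ((measurable_pi_apply r).comp (hq_meas i)).comp_aemeasurable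
        ((hchat_meas n).sub_const c)
    · exact (measurable_matrix_inv_apply r s).comp_aemeasurable hMm
  have hDlim : ∀ᵐ ω ∂P, Tendsto (fun n => D n ω) atTop (𝓝 (B * Sig⁻¹)) := by
    filter_upwards [hcons, hMinv] with ω h1 h2
    have h3 : Tendsto (fun n => (Matrix.of fun i => q i (chat n ω - c) : Matrix (Fin d) L ℝ))
        atTop (𝓝 B) :=
      tendsto_pi_nhds.2 fun i => (hq_lim i).comp h1
    exact tendsto_matrix_mul h3 h2
  have hmain := TendstoInDistribution.mulVec_of_ae_tendsto hclt hDmeas hDlim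
    (T := fun (n : ℕ) (ω : Ω) => (WithLp.toLp 2 (fun i : Fin d =>
      √(n : ℝ) * (PCE.sobolIndex L (chat n ω) i - PCE.sobolIndex L c i)) :
        EuclideanSpace ℝ (Fin d))) ?_ ?_
  · refine TendstoInDistribution.id_of_hasLaw hmain ?_
    -- Symmetry of `Sig` turns `(B Σ⁻¹)ᵀ` into `Σ⁻¹ Bᵀ`.
    have h1 : PCE.limitCov μ ψ L f c Sig = B * Sig⁻¹ * Γ * (B * Sig⁻¹)ᵀ := by
      rw [PCE.limitCov, Matrix.transpose_mul, Matrix.transpose_nonsing_inv, hSig_symm.eq]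
      simp only [Matrix.mul_assoc]
      rfl
    rw [h1]
    exact hasLaw_multivariateGaussian_mulVec hΓpsd (B * Sig⁻¹)
  · refine fun n => (WithLp.measurable_toLp 2 _).comp_aemeasurable
      (aemeasurable_pi_iff.2 fun i => ?_)
    exact (((PCE.measurable_sobolIndex i).comp_aemeasurable (hchat_meas n)).sub_const _).const_mul _
  · filter_upwards [herr] with ω hω
    filter_upwards [hω] with n hn
    -- The scalings agree because `√n / n = 1 / √n`, which under Lean's conventions also holds at `n
    -- = 0`.
    have h1 : (Matrix.of (D n ω)) *ᵥ ((√(n : ℝ))⁻¹ • ∑ k ∈ Finset.range n, Y k ω).ofLp =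
        √(n : ℝ) • ((Matrix.of fun i => q i (chat n ω - c)) *ᵥ (chat n ω - c)) := by
      conv_rhs => rw [hn, Matrix.mulVec_mulVec, ← Matrix.mulVec_smul]
      rw [← hn, WithLp.ofLp_smul, WithLp.ofLp_smul, smul_smul, ← div_eq_mul_inv,
        Real.sqrt_div_self', one_div]
      rfl
    rw [h1]
    congr 1
    ext i
    have h2 := hq i (chat n ω - c)
    rw [add_sub_cancel] at h2
    rw [h2]
    rfl
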